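/- A closed plane curve is given by a 1-periodic $C^2$ immersion $u\mapsto \mathbf f(u)\in\mathbb R^2$, with arc length $ds=|\partial_u \mathbf f|\,du$, length $L$, unit tangent $\boldsymbol\tau=\partial_s\mathbf f$, unit normal $\boldsymbol\nu$ ($\boldsymbol\tau$ rotated counter-clockwise by $\pi/2$), curvature $\kappa=\partial_s^2\mathbf f\cdot\boldsymbol\nu$, $\tilde\kappa=\kappa-\frac1L\int_0^L\kappa\,ds$, signed area $A=-\frac12\int_0^L\mathbf f\cdot\boldsymbol\nu\,ds$, rotation number $n=\frac1{2\pi}\int_0^L\kappa\,ds$ and isoperimetric deficit $I_{-1}=1-\frac{4\pi nA}{L^2}$. Consider the flow $$\partial_t\mathbf f=\Big(\tilde\kappa-\frac gL\Big)\boldsymbol\nu ,$$ where $g$ is one of the following: - (AP) $g=0$; - (LP) $g=L\big(\int_0^L\kappa\,ds\big)^{-1}\int_0^L\tilde\kappa^2\,ds$; - (JP) $g=\frac{L^2}{2A}-\int_0^L\kappa\,ds$. A classical solution on $[0,T)$, $0<T\le\infty$, is a family $\mathbf f(u,t)$ of closed immersed curves for which $\mathbf f,\partial_u\mathbf f,\partial_u^2\mathbf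 f$ are continuous on $\mathbb R\times[0,T)$, the denominator in $g$ (if any) does not vanish, and the equation holds for $0<t<T$. Its maximum existence time is $T$ if it does not extend to a classical solution on a longer interval $[0,T')$. **Theorem.** Let $\mathbf f$ be a classical solution of (AP), (LP) or (JP) on $[0,T)$, where $T\in(0,\infty]$ is its maximum existence time. Assume that the initial curve is smooth, has rotation number $n$, and satisfies $A(0)>0$ and $I_{-1}(0)<0$. Then the solution blows up in finite time, i.e. $T<\infty$, and - for (AP): $\displaystyle T\le\frac{L(0)^2-4\pi A(0)}{-8\pi^2 n\,I_{-1}(0)}$; - for (LP): $\displaystyle T\le\frac{L(0)^2-4\pi A(0)}{-8\pi^2\,I_{-1}(0)}$; - for (JP): $\displaystyle T\le\frac{L(0)^2}{-8\pi^2 n\,I_{-1}(0)}$. -/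

import Mathlib

open scoped ContDiff

noncomputable section

namespace PlaneFlow

/-! Closed plane curves are `1`-periodic immersions `X : ℝ → ℂ`, where `ℂ` is the Euclidean plane
`ℝ²`. With the arc length `s`, one has `ds = ‖X' u‖ du` and `∂_s = ‖X' u‖⁻¹ ∂_u`. -/

/-- The integral `∫₀ᴸ φ ds` over one period of the curve. -/
def arcIntegral (X : ℝ → ℂ) (φ : ℝ → ℝ) : ℝ :=
  ∫ u in (0 : ℝ)..1, φ u * ‖deriv X u‖

/-- The arc-length derivative `∂_s Y` along the curve `X`. -/
def arcDeriv (X Y : ℝ → ℂ) (u : ℝ) : ℂ :=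
  ‖deriv X u‖⁻¹ • deriv Y u

/-- The total length `L`. -/
def length (X : ℝ → ℂ) : ℝ :=
  arcIntegral X (fun _ => 1)

/-- The unit tangent `τ = ∂_s X`. -/
def tangent (X : ℝ → ℂ) : ℝ → ℂ :=
  arcDeriv X X

/-- The unit normal `ν`: the tangent rotated counter-clockwise by `π / 2`. -/
def normal (X : ℝ → ℂ) (u : ℝ) : ℂ :=
  Complex.I * tangent X u

/-- The curvature vector `∂_s² X`. -/
def curvatureVector (X : ℝ → ℂ) : ℝ → ℂ :=
  arcDeriv X (tangent X)

/-- The signed curvature `κ`. -/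
def curvature (X : ℝ → ℂ) (u : ℝ) : ℝ :=
  inner ℝ (curvatureVector X u) (normal X u)

/-- The total curvature `∫₀ᴸ κ ds`. -/
def totalCurvature (X : ℝ → ℂ) : ℝ :=
  arcIntegral X (curvature X)

/-- The deviation of the curvature from its mean, `κ - L⁻¹ ∫₀ᴸ κ ds`. -/
def curvatureDeviation (X : ℝ → ℂ) (u : ℝ) : ℝ :=
  curvature X u - totalCurvature X / length X

/-- The signed enclosed area `A = -(1/2) ∫₀ᴸ X · ν ds`. -/
def area (X : ℝ → ℂ) : ℝ :=
  -(1 / 2) * arcIntegral X (fun u => inner ℝ (X u) (normal X u))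

/-- The rotation number `n = (2π)⁻¹ ∫₀ᴸ κ ds`. -/
def rotationNumber (X : ℝ → ℂ) : ℝ :=
  totalCurvature X / (2 * Real.pi)

/-- The isoperimetric deficit `I₋₁ = 1 - 4πnA / L²`. -/
def isoperimetricDeficit (X : ℝ → ℂ) : ℝ :=
  1 - 4 * Real.pi * rotationNumber X * area X / length X ^ 2

/-- The three flows: area-preserving, length-preserving, and that of Jiang and Pan. -/
inductive Flow : Type
  | AP
  | LP
  | JP

/-- The scale-invariant non-local quantity `g` of each flow. -/
def nonlocalTerm : Flow → (ℝ → ℂ) → ℝ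
  | Flow.AP, _ => 0
  | Flow.LP, X =>
      length X * (totalCurvature X)⁻¹ * arcIntegral X (fun u => curvatureDeviation X u ^ 2)
  | Flow.JP, X => length X ^ 2 / (2 * area X) - totalCurvature X

/-- The denominator in the non-local quantity `g` does not vanish. -/
def NonlocalTermDefined : Flow → (ℝ → ℂ) → Prop
  | Flow.AP, _ => True
  | Flow.LP, X => totalCurvature X ≠ 0
  | Flow.JP, X => area X ≠ 0

/-- `f` (with `f t u` the position at time `t` of the point with parameter `u`) is a classical
solution on `[0, T)`, `0 < T ≤ ∞`, of `∂_t f = (κ - L⁻¹ ∫ κ ds - g / L) ν`: a family of closed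
immersed curves, twice differentiable in `u` with `f`, `∂_u f`, `∂_u² f` jointly continuous on
`[0, T) × ℝ`, and satisfying the equation for `0 < t < T`. (The equation makes `∂_t f`
continuous as well, up to `t = 0`.) -/
structure IsClassicalSolution (F : Flow) (T : EReal) (f : ℝ → ℝ → ℂ) : Prop where
  pos : 0 < T
  periodic : ∀ t : ℝ, 0 ≤ t → (t : EReal) < T → ∀ u : ℝ, f t (u + 1) = f t u
  contDiff : ∀ t : ℝ, 0 ≤ t → (t : EReal) < T → ContDiff ℝ 2 (f t)
  immersed : ∀ t : ℝ, 0 ≤ t → (t : EReal) < T → ∀ u : ℝ, deriv (f t) u ≠ 0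
  continuousOn : ContinuousOn (fun p : ℝ × ℝ => f p.1 p.2)
    {p : ℝ × ℝ | 0 ≤ p.1 ∧ (p.1 : EReal) < T}
  continuousOn_deriv : ContinuousOn (fun p : ℝ × ℝ => deriv (f p.1) p.2)
    {p : ℝ × ℝ | 0 ≤ p.1 ∧ (p.1 : EReal) < T}
  continuousOn_deriv_two : ContinuousOn (fun p : ℝ × ℝ => iteratedDeriv 2 (f p.1) p.2)
    {p : ℝ × ℝ | 0 ≤ p.1 ∧ (p.1 : EReal) < T}
  defined : ∀ t : ℝ, 0 ≤ t → (t : EReal) < T → NonlocalTermDefined F (f t)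
  equation : ∀ t : ℝ, 0 < t → (t : EReal) < T → ∀ u : ℝ,
    HasDerivAt (fun t' : ℝ => f t' u)
      ((curvatureDeviation (f t) u - nonlocalTerm F (f t) / length (f t)) • normal (f t) u) t

/-- `f` is a classical solution on `[0, T)` and `T` is its maximum existence time: `f` has no
extension to a classical solution on a longer interval `[0, T')`. -/
structure IsMaximalClassicalSolution (F : Flow) (T : EReal) (f : ℝ → ℝ → ℂ) : Prop where
  isSolution : IsClassicalSolution F T f
  maximal : ∀ (T' : EReal) (f' : ℝ → ℝ → ℂ), T < T' → IsClassicalSolution F T' f' →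
    ¬ ∀ t : ℝ, 0 ≤ t → (t : EReal) < T → f' t = f t

end PlaneFlow

end

/-! Put D = 4πnA − L². The area satisfies A' = g and the length L' = 2πn g/L − ∫κ̃² ds, so the
nonlocal terms cancel and D' = 2L∫κ̃² ds ≥ 0 for every choice of g. The hypothesis I₋₁(0) < 0 says
D(0) > 0.

The decisive estimate is `neg_isoperimetricDeficit_le`: L∫κ̃² ds ≥ −4π²n I₋₁. It is Hurwitz's
inequality (Wirtinger plus Cauchy–Schwarz) applied to −(L/2π)ν − nX instead of X; applied to X
itself it is the isoperimetric inequality.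

In all three flows L does not increase, so −I₋₁ = D/L² does not decrease, and D grows at least at
the constant rate −8π²n I₋₁(0) > 0 (`mul_le_deficit_sub`). But D is bounded above: through L² ≥ 4πA
when A or L is conserved, and through the decrease of A for (JP). This bounds every time in [0, T).

Only two u-derivatives and the first t-derivative of f are at hand, so |∂_u f| cannot be
differentiated in t. The length is differentiated by squeezing its difference quotients between two
bounds given by the convexity of the norm. -/

namespace PlaneFlow

open MeasureTheory

/-! ### Wirtinger's and Hurwitz's inequalities. -/

/-- Wirtinger's inequality on the unit interval, for a function with equal boundary values. -/
theorem exists_integral_norm_sub_sq_le {w w' : ℝ → ℂ} (hw : ∀ u, HasDerivAt w (w' u) u)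
    (hw' : Continuous w') (hper : w 1 = w 0) :
    ∃ c : ℂ, (2 * Real.pi) ^ 2 * ∫ u in (0 : ℝ)..1, ‖w u - c‖ ^ 2 ≤
      ∫ u in (0 : ℝ)..1, ‖w' u‖ ^ 2 := by
  have hwc : Continuous w := continuous_iff_continuousAt.2 fun u => (hw u).continuousAt
  have mem : ∀ {f : ℝ → ℂ}, Continuous f → MemLp f 2 (volume.restrict (Set.Ioc (0 : ℝ) 1)) := by
    intro f hf
    refine (memLp_two_iff_integrable_sq_norm hf.aestronglyMeasurable).2 ?_
    exact ((hf.norm.pow 2).continuousOn.integrableOn_compact isCompact_Icc).mono_set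
      Set.Ioc_subset_Icc_self
  -- Subtracting the mean kills the zeroth Fourier coefficient. By Parseval the rest is a termwise
  -- comparison, the i-th coefficient of w' being 2πi·I times that of w.
  refine ⟨∫ u in (0 : ℝ)..1, w u, ?_⟩
  set c : ℂ := ∫ u in (0 : ℝ)..1, w u with hc
  have hg : ∀ u, HasDerivAt (fun u => w u - c) (w' u) u := fun u => (hw u).sub_const c
  have hgc : Continuous fun u => w u - c := hwc.sub continuous_const
  have h1 := hasSum_sq_fourierCoeffOn zero_lt_one (mem hgc)
  have h2 := hasSum_sq_fourierCoeffOn zero_lt_one (mem hw')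
  simp only [sub_zero, inv_one, one_smul] at h1 h2
  refine hasSum_le (fun i => ?_) (h1.mul_left ((2 * Real.pi) ^ 2)) h2
  rcases eq_or_ne i 0 with rfl | hi
  · have : fourierCoeffOn zero_lt_one (fun u => w u - c) 0 = 0 := by
      rw [fourierCoeffOn_eq_integral]
      simp [intervalIntegral.integral_sub (hwc.intervalIntegrable 0 1)
        (continuous_const.intervalIntegrable 0 1), hc]
    rw [this]
    simp
  · have h := fourierCoeffOn_of_hasDerivAt zero_lt_one (n := i) hi (fun x _ => hg x)
      (hw'.intervalIntegrable 0 1)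
    rw [h, hper]
    have hi1 : (1 : ℝ) ≤ (i : ℝ) ^ 2 := by
      have : (1 : ℤ) ≤ i ^ 2 := by
        have := sq_pos_of_ne_zero hi
        omega
      exact_mod_cast this
    simp only [sub_self, mul_zero, zero_sub, Complex.ofReal_one, Complex.ofReal_zero, sub_zero,
      one_mul, norm_mul, norm_neg, norm_div, norm_one, RCLike.norm_ofNat, Complex.norm_real,
      Complex.norm_I, Complex.norm_intCast, mul_one, mul_pow, div_pow, one_pow, sq_abs,
      Real.norm_eq_abs]
    have hpi := Real.pi_pos
    have : 2 ^ 2 * Real.pi ^ 2 * (1 / (2 ^ 2 * Real.pi ^ 2 * (i : ℝ) ^ 2) *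
        ‖fourierCoeffOn zero_lt_one w' i‖ ^ 2) =
        ‖fourierCoeffOn zero_lt_one w' i‖ ^ 2 / (i : ℝ) ^ 2 := by
      field_simp
    rw [this]
    exact div_le_self (by positivity) hi1

/-- Hurwitz's form of the isoperimetric inequality, for a parametrization of the unit interval. -/
theorem hurwitz_unit {w w' : ℝ → ℂ} (hw : ∀ u, HasDerivAt w (w' u) u)
    (hw' : Continuous w') (hper : w 1 = w 0) :
    2 * Real.pi * ∫ u in (0 : ℝ)..1, inner ℝ (Complex.I * w u) (w' u) ≤
      ∫ u in (0 : ℝ)..1, ‖w' u‖ ^ 2 := by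
  have hwc : Continuous w := continuous_iff_continuousAt.2 fun u => (hw u).continuousAt
  obtain ⟨c, hc⟩ := exists_integral_norm_sub_sq_le hw hw' hper
  have hpi := Real.pi_pos
  -- The left side does not see translations of w, so Wirtinger's constant c may be subtracted.
  have h0 : ∫ u in (0 : ℝ)..1, inner ℝ (Complex.I * c) (w' u) = 0 := by
    rw [intervalIntegral.integral_eq_sub_of_hasDerivAt
      (f := fun u => inner ℝ (Complex.I * c) (w u)) (fun u _ => by
        simpa using (hasDerivAt_const u (Complex.I * c)).inner ℝ (hw u))
      (Continuous.intervalIntegrable (by fun_prop) _ _), hper, sub_self]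
  have h1 : ∫ u in (0 : ℝ)..1, inner ℝ (Complex.I * w u) (w' u) =
      ∫ u in (0 : ℝ)..1, inner ℝ (Complex.I * (w u - c)) (w' u) := by
    simp only [mul_sub, inner_sub_left]
    rw [intervalIntegral.integral_sub (Continuous.intervalIntegrable (by fun_prop) _ _)
        (Continuous.intervalIntegrable (by fun_prop) _ _), h0, sub_zero]
  have h2 : ∫ u in (0 : ℝ)..1, 2 * (2 * Real.pi) * inner ℝ (Complex.I * (w u - c)) (w' u) ≤
      ∫ u in (0 : ℝ)..1, ((2 * Real.pi) ^ 2 * ‖w u - c‖ ^ 2 + ‖w' u‖ ^ 2) := by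
    refine intervalIntegral.integral_mono_on zero_le_one
      (Continuous.intervalIntegrable (by fun_prop) _ _)
      (Continuous.intervalIntegrable (by fun_prop) _ _) fun u _ => ?_
    have h := real_inner_le_norm (Complex.I * (w u - c)) (w' u)
    rw [norm_mul, Complex.norm_I, one_mul] at h
    nlinarith [sq_nonneg (2 * Real.pi * ‖w u - c‖ - ‖w' u‖)]
  rw [intervalIntegral.integral_add (Continuous.intervalIntegrable (by fun_prop) _ _)
    (Continuous.intervalIntegrable (by fun_prop) _ _), intervalIntegral.integral_const_mul,
    intervalIntegral.integral_const_mul] at h2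
  rw [h1]
  linarith

/-- Hurwitz's form of the isoperimetric inequality, with respect to a length element `v du`. -/
theorem hurwitz {v : ℝ → ℝ} (hv : Continuous v) (hpos : ∀ u, 0 < v u)
    (hvper : Function.Periodic v 1) {w w' : ℝ → ℂ} (hw : ∀ u, HasDerivAt w (w' u) u)
    (hw' : Continuous w') (hper : w 1 = w 0) :
    2 * Real.pi * ∫ u in (0 : ℝ)..1, inner ℝ (Complex.I * w u) (w' u) ≤
      (∫ u in (0 : ℝ)..1, v u) * ∫ u in (0 : ℝ)..1, ‖w' u‖ ^ 2 / v u := by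
  have hwc : Continuous w := continuous_iff_continuousAt.2 fun u => (hw u).continuousAt
  set L : ℝ := ∫ u in (0 : ℝ)..1, v u with hL
  have hL0 : 0 < L := intervalIntegral.intervalIntegral_pos_of_pos
    (hv.intervalIntegrable _ _) hpos zero_lt_one
  -- Normalized arc length. Periodicity of v makes φ a bijection of the whole line, so its inverse
  -- is differentiable everywhere, including the endpoints 0 and 1; w ∘ φ⁻¹ then falls under
  -- `hurwitz_unit`.
  set φ : ℝ → ℝ := fun u => L⁻¹ * ∫ x in (0 : ℝ)..u, v x with hφ
  have hφd : ∀ u, HasDerivAt φ (L⁻¹ * v u) u := fun u =>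
    (hv.integral_hasStrictDerivAt 0 u).hasDerivAt.const_mul _
  have hφpos : ∀ u, 0 < L⁻¹ * v u := fun u => mul_pos (inv_pos.2 hL0) (hpos u)
  have hφc : Continuous φ := continuous_iff_continuousAt.2 fun u => (hφd u).continuousAt
  have hφm : StrictMono φ := strictMono_of_hasDerivAt_pos hφd hφpos
  have hφ0 : φ 0 = 0 := by simp [hφ]
  have hφ1 : φ 1 = 1 := by simp [hφ, ← hL, hL0.ne']
  have hφs : Function.Surjective φ := by
    refine hφc.surjective ?_ ?_
    · exact (hvper.tendsto_atTop_intervalIntegral_of_pos' 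
        (hv.intervalIntegrable _ _) hpos zero_lt_one).const_mul_atTop (inv_pos.2 hL0)
    · exact (hvper.tendsto_atBot_intervalIntegral_of_pos' 
        (hv.intervalIntegrable _ _) hpos zero_lt_one).const_mul_atBot (inv_pos.2 hL0)
  set e := hφm.orderIsoOfSurjective φ hφs
  have hσφ : ∀ u, e.symm (φ u) = u := fun u => e.symm_apply_apply u
  have hφσ : ∀ y, φ (e.symm y) = y := fun y => e.apply_symm_apply y
  have hσc : Continuous e.symm := e.symm.continuous
  have hσd : ∀ y, HasDerivAt e.symm (L⁻¹ * v (e.symm y))⁻¹ y := fun y =>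
    (hφd (e.symm y)).of_local_left_inverse hσc.continuousAt (hφpos _).ne'
      (Filter.Eventually.of_forall hφσ)
  have hσ0 : e.symm 0 = 0 := by rw [← hφ0, hσφ, hφ0]
  have hσ1 : e.symm 1 = 1 := by rw [← hφ1, hσφ, hφ1]
  have hinv : Continuous fun u => (L⁻¹ * v u)⁻¹ :=
    (continuous_const.mul hv).inv₀ fun u => (hφpos u).ne'
  have key := hurwitz_unit (w := fun y => w (e.symm y))
    (w' := fun y => (L⁻¹ * v (e.symm y))⁻¹ • w' (e.symm y))
    (fun y => (hw (e.symm y)).scomp y (hσd y))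
    ((hinv.comp hσc).smul (hw'.comp hσc)) (by rw [hσ0, hσ1, hper])
  have sub : ∀ g : ℝ → ℝ, Continuous g →
      ∫ y in (0 : ℝ)..1, g (e.symm y) = ∫ u in (0 : ℝ)..1, g u * (L⁻¹ * v u) := by
    intro g hg
    have := intervalIntegral.integral_comp_mul_deriv (a := 0) (b := 1) (f := φ)
      (g := fun y => g (e.symm y)) (fun x _ => hφd x)
      (Continuous.continuousOn (by fun_prop)) (hg.comp hσc)
    rw [hφ0, hφ1] at this
    rw [← this]
    simp [hσφ]
  rw [sub (fun u => inner ℝ (Complex.I * w u) ((L⁻¹ * v u)⁻¹ • w' u)) (by fun_prop),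
    sub (fun u => ‖(L⁻¹ * v u)⁻¹ • w' u‖ ^ 2) (by fun_prop)] at key
  rw [← intervalIntegral.integral_const_mul L]
  have e1 : ∀ u, inner ℝ (Complex.I * w u) ((L⁻¹ * v u)⁻¹ • w' u) * (L⁻¹ * v u) =
      inner ℝ (Complex.I * w u) (w' u) := fun u => by
    rw [real_inner_smul_right, mul_right_comm, inv_mul_cancel₀ (hφpos u).ne', one_mul]
  have e2 : ∀ u, ‖(L⁻¹ * v u)⁻¹ • w' u‖ ^ 2 * (L⁻¹ * v u) = L * (‖w' u‖ ^ 2 / v u) := fun u => by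
    have := hpos u
    rw [norm_smul, mul_pow, Real.norm_eq_abs, sq_abs]
    field_simp
  simpa only [e1, e2] using key

/-! ### Geometry of a single closed curve. -/

/-- A closed immersed plane curve of class `C²`. -/
structure IsClosedCurve (X : ℝ → ℂ) : Prop where
  contDiff : ContDiff ℝ 2 X
  periodic : ∀ u, X (u + 1) = X u
  immersed : ∀ u, deriv X u ≠ 0

namespace IsClosedCurve

variable {X : ℝ → ℂ}

theorem hasDerivAt (hX : IsClosedCurve X) (u : ℝ) : HasDerivAt X (deriv X u) u :=
  ((hX.contDiff.differentiable (by norm_num)) u).hasDerivAt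

theorem continuous (hX : IsClosedCurve X) : Continuous X := hX.contDiff.continuous

theorem contDiff_deriv (hX : IsClosedCurve X) : ContDiff ℝ 1 (deriv X) :=
  ((contDiff_succ_iff_deriv (n := 1)).1 (by simpa using! hX.contDiff)).2.2

theorem continuous_deriv (hX : IsClosedCurve X) : Continuous (deriv X) := hX.contDiff_deriv.continuous

theorem hasDerivAt_deriv (hX : IsClosedCurve X) (u : ℝ) : HasDerivAt (deriv X) (iteratedDeriv 2 X u) u := by
  have := ((hX.contDiff_deriv.differentiable (by norm_num)) u).hasDerivAt
  rwa [show iteratedDeriv 2 X = deriv (deriv X) by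
    rw [iteratedDeriv_succ, iteratedDeriv_one]]

theorem continuous_iteratedDeriv_two (hX : IsClosedCurve X) : Continuous (iteratedDeriv 2 X) :=
  hX.contDiff.continuous_iteratedDeriv 2 le_rfl

theorem deriv_periodic (hX : IsClosedCurve X) (u : ℝ) : deriv X (u + 1) = deriv X u := by
  rw [← deriv_comp_add_const]
  exact congrArg (fun Y => deriv Y u) (funext hX.periodic)

theorem speed_pos (hX : IsClosedCurve X) (u : ℝ) : 0 < ‖deriv X u‖ := norm_pos_iff.2 (hX.immersed u)

theorem length_eq : length X = ∫ u in (0 : ℝ)..1, ‖deriv X u‖ := by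
  simp [length, arcIntegral]

theorem length_pos (hX : IsClosedCurve X) : 0 < length X := by
  rw [length_eq]
  exact intervalIntegral.intervalIntegral_pos_of_pos
    (hX.continuous_deriv.norm.intervalIntegrable _ _) hX.speed_pos zero_lt_one

theorem speed_smul_tangent (hX : IsClosedCurve X) (u : ℝ) : ‖deriv X u‖ • tangent X u = deriv X u := by
  rw [tangent, arcDeriv, smul_smul, mul_inv_cancel₀ (hX.speed_pos u).ne', one_smul]

theorem norm_tangent (hX : IsClosedCurve X) (u : ℝ) : ‖tangent X u‖ = 1 := by
  rw [tangent, arcDeriv, norm_smul, norm_inv, norm_norm, inv_mul_cancel₀ (hX.speed_pos u).ne']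

theorem norm_normal (hX : IsClosedCurve X) (u : ℝ) : ‖normal X u‖ = 1 := by
  rw [normal, norm_mul, Complex.norm_I, one_mul, hX.norm_tangent]

theorem contDiff_tangent (hX : IsClosedCurve X) : ContDiff ℝ 1 (tangent X) :=
  ((hX.contDiff_deriv.norm ℝ hX.immersed).inv fun u => (hX.speed_pos u).ne').smul
    hX.contDiff_deriv

theorem continuous_tangent (hX : IsClosedCurve X) : Continuous (tangent X) := hX.contDiff_tangent.continuous

theorem continuous_normal (hX : IsClosedCurve X) : Continuous (normal X) := continuous_const.mul hX.continuous_tangent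

theorem tangent_periodic (hX : IsClosedCurve X) (u : ℝ) : tangent X (u + 1) = tangent X u := by
  rw [tangent, arcDeriv, arcDeriv, hX.deriv_periodic]

theorem deriv_tangent_eq_speed_smul (hX : IsClosedCurve X) (u : ℝ) :
    deriv (tangent X) u = ‖deriv X u‖ • curvatureVector X u := by
  rw [curvatureVector, arcDeriv, smul_smul, mul_inv_cancel₀ (hX.speed_pos u).ne', one_smul]

/-- Frenet's formula: τ has constant norm, so its derivative is orthogonal to τ and hence a multiple
of ν. -/
theorem deriv_tangent (hX : IsClosedCurve X) (u : ℝ) :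
    deriv (tangent X) u = (curvature X u * ‖deriv X u‖) • normal X u := by
  have hd : HasDerivAt (tangent X) (deriv (tangent X) u) u :=
    (hX.contDiff_tangent.differentiable (by norm_num) u).hasDerivAt
  have hsq : ∀ x, inner ℝ (tangent X x) (tangent X x) = 1 := fun x => by
    rw [real_inner_self_eq_norm_sq, hX.norm_tangent, one_pow]
  have h0 : inner ℝ (tangent X u) (deriv (tangent X) u) = 0 := by
    have h := hd.inner ℝ hd
    simp only [hsq] at h
    have := h.unique (hasDerivAt_const u (1 : ℝ))
    rw [real_inner_comm (tangent X u) (deriv (tangent X) u)] at this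
    linarith
  have h1 : curvature X u * ‖deriv X u‖ = inner ℝ (deriv (tangent X) u) (normal X u) := by
    rw [curvature, hX.deriv_tangent_eq_speed_smul, real_inner_smul_left, mul_comm]
  have hn := hsq u
  rw [h1, normal]
  simp only [Complex.inner, Complex.mul_re, Complex.conj_re, Complex.conj_im, Complex.mul_im,
    Complex.I_re, Complex.I_im] at h0 hn ⊢
  apply Complex.ext
  · simp only [Complex.real_smul, Complex.mul_re, Complex.ofReal_re, Complex.ofReal_im,
      Complex.I_re, Complex.I_im, Complex.mul_im]
    linear_combination (-(deriv (tangent X) u).re) * hn + (tangent X u).re * h0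
  · simp only [Complex.real_smul, Complex.mul_re, Complex.ofReal_re, Complex.ofReal_im,
      Complex.I_re, Complex.I_im, Complex.mul_im]
    linear_combination (-(deriv (tangent X) u).im) * hn + (tangent X u).im * h0

theorem hasDerivAt_tangent (hX : IsClosedCurve X) (u : ℝ) :
    HasDerivAt (tangent X) ((curvature X u * ‖deriv X u‖) • normal X u) u := by
  rw [← hX.deriv_tangent]
  exact (hX.contDiff_tangent.differentiable (by norm_num) u).hasDerivAt

/-- Expand the derivative of X'/|X'|; the part along X' is orthogonal to ν. This form makes κ
continuous in (t, u) as soon as the first two u-derivatives are. -/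
theorem curvature_eq (hX : IsClosedCurve X) (u : ℝ) : curvature X u =
    inner ℝ (iteratedDeriv 2 X u) (Complex.I * deriv X u) / ‖deriv X u‖ ^ 3 := by
  have hv := hX.speed_pos u
  have hd : HasDerivAt (fun x => ‖deriv X x‖⁻¹)
      (deriv (fun x => ‖deriv X x‖⁻¹) u) u :=
    (((hX.contDiff_deriv.norm ℝ hX.immersed).inv fun u => (hX.speed_pos u).ne').differentiable
      (by norm_num) u).hasDerivAt
  have h := (hd.smul (hX.hasDerivAt_deriv u)).unique (hX.hasDerivAt_tangent u)
  have h2 := congrArg (fun z => inner ℝ z (normal X u)) h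
  have hperp : inner ℝ (deriv X u) (Complex.I * deriv X u) = 0 := by
    simp only [Complex.inner, Complex.mul_re, Complex.conj_re, Complex.conj_im, Complex.mul_im,
      Complex.I_re, Complex.I_im]
    ring
  have hn : normal X u = ‖deriv X u‖⁻¹ • (Complex.I * deriv X u) := by
    rw [normal, tangent, arcDeriv, mul_smul_comm]
  simp only [inner_add_left, real_inner_smul_left, real_inner_self_eq_norm_sq,
    hX.norm_normal] at h2
  rw [hn] at h2
  simp only [real_inner_smul_right, hperp] at h2
  field_simp at h2 ⊢
  linarith

theorem continuous_curvature (hX : IsClosedCurve X) : Continuous (curvature X) := by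
  rw [funext hX.curvature_eq]
  exact (hX.continuous_iteratedDeriv_two.inner (continuous_const.mul hX.continuous_deriv)).div
    (hX.continuous_deriv.norm.pow 3) fun u => (pow_pos (hX.speed_pos u) 3).ne'

theorem continuous_curvatureDeviation (hX : IsClosedCurve X) : Continuous (curvatureDeviation X) :=
  hX.continuous_curvature.sub continuous_const

theorem arcIntegral_add (hX : IsClosedCurve X) {φ ψ : ℝ → ℝ} (hφ : Continuous φ) (hψ : Continuous ψ) :
    arcIntegral X (fun u => φ u + ψ u) = arcIntegral X φ + arcIntegral X ψ := by
  have := hX.continuous_deriv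
  simp only [arcIntegral, add_mul]
  exact intervalIntegral.integral_add (Continuous.intervalIntegrable (by fun_prop) _ _)
    (Continuous.intervalIntegrable (by fun_prop) _ _)

theorem arcIntegral_const_mul (c : ℝ) (φ : ℝ → ℝ) :
    arcIntegral X (fun u => c * φ u) = c * arcIntegral X φ := by
  simp only [arcIntegral, mul_assoc]
  exact intervalIntegral.integral_const_mul _ _

theorem arcIntegral_const (c : ℝ) : arcIntegral X (fun _ => c) = c * length X := by
  rw [length, ← arcIntegral_const_mul]
  simp

theorem arcIntegral_nonneg {φ : ℝ → ℝ} (hφ : ∀ u, 0 ≤ φ u) : 0 ≤ arcIntegral X φ :=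
  intervalIntegral.integral_nonneg zero_le_one fun u _ => mul_nonneg (hφ u) (norm_nonneg _)

theorem arcIntegral_curvatureDeviation (hX : IsClosedCurve X) : arcIntegral X (curvatureDeviation X) = 0 := by
  have h := hX.arcIntegral_add hX.continuous_curvature
    (continuous_const (y := -(totalCurvature X / length X)))
  have := hX.length_pos
  rw [arcIntegral_const] at h
  simp only [← sub_eq_add_neg] at h
  change arcIntegral X (curvatureDeviation X) = totalCurvature X + _ at h
  rw [h]
  field_simp
  ring

/-- κ and κ̃ differ by a constant, and κ̃ has mean zero. -/
theorem arcIntegral_curvature_mul_curvatureDeviation (hX : IsClosedCurve X) :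
    arcIntegral X (fun u => curvature X u * curvatureDeviation X u) =
      arcIntegral X (fun u => curvatureDeviation X u ^ 2) := by
  have hc := hX.continuous_curvatureDeviation
  have h := hX.arcIntegral_add (φ := fun u => curvatureDeviation X u ^ 2) (hc.pow 2)
    (hc.const_mul (totalCurvature X / length X))
  rw [arcIntegral_const_mul, hX.arcIntegral_curvatureDeviation, mul_zero, add_zero] at h
  rw [← h]
  congr 1
  funext u
  simp only [curvatureDeviation]
  ring

theorem arcIntegral_inner_normal :
    arcIntegral X (fun u => inner ℝ (X u) (normal X u)) = -2 * area X := by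
  rw [area]
  ring

/-- Integrate ∂_s⟨X, τ⟩ = 1 + κ⟨X, ν⟩ around the closed curve. -/
theorem arcIntegral_curvature_mul_inner_normal (hX : IsClosedCurve X) :
    arcIntegral X (fun u => curvature X u * inner ℝ (X u) (normal X u)) = -length X := by
  have hX0 := hX.continuous
  have hX1 := hX.continuous_deriv
  have hn := hX.continuous_normal
  have hk := hX.continuous_curvature
  have h : ∫ u in (0 : ℝ)..1, (inner ℝ (X u) ((curvature X u * ‖deriv X u‖) • normal X u) +
      inner ℝ (deriv X u) (tangent X u)) = 0 := by
    rw [intervalIntegral.integral_eq_sub_of_hasDerivAt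
      (f := fun u => inner ℝ (X u) (tangent X u))
      (fun u _ => (hX.hasDerivAt u).inner ℝ (hX.hasDerivAt_tangent u))
      (Continuous.intervalIntegrable
        (by have := hX.continuous_tangent; fun_prop) _ _)]
    have h1 := hX.periodic 0
    have h2 := hX.tangent_periodic 0
    rw [zero_add] at h1 h2
    rw [h1, h2, sub_self]
  have h1 : ∀ u, inner ℝ (deriv X u) (tangent X u) = 1 * ‖deriv X u‖ := fun u => by
    nth_rewrite 1 [← hX.speed_smul_tangent u]
    rw [real_inner_smul_left, real_inner_self_eq_norm_sq, hX.norm_tangent]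
    ring
  have h2 : ∀ u, inner ℝ (X u) ((curvature X u * ‖deriv X u‖) • normal X u) =
      curvature X u * inner ℝ (X u) (normal X u) * ‖deriv X u‖ := fun u => by
    rw [real_inner_smul_right]
    ring
  simp only [h1, h2] at h
  rw [intervalIntegral.integral_add (Continuous.intervalIntegrable (by fun_prop) _ _)
    (Continuous.intervalIntegrable (by fun_prop) _ _)] at h
  rw [length, arcIntegral, arcIntegral]
  linarith

theorem totalCurvature_eq : totalCurvature X = 2 * Real.pi * rotationNumber X := by
  rw [rotationNumber]
  field_simp

theorem arcIntegral_curvatureDeviation_mul_inner_normal (hX : IsClosedCurve X) :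
    arcIntegral X (fun u => curvatureDeviation X u * inner ℝ (X u) (normal X u)) =
      -(length X * isoperimetricDeficit X) := by
  have hc : Continuous fun u => inner ℝ (X u) (normal X u) :=
    hX.continuous.inner hX.continuous_normal
  have h := hX.arcIntegral_add
    (φ := fun u => curvature X u * inner ℝ (X u) (normal X u)) (hX.continuous_curvature.mul hc)
    (hc.const_mul (-(totalCurvature X / length X)))
  rw [hX.arcIntegral_curvature_mul_inner_normal, arcIntegral_const_mul,
    arcIntegral_inner_normal, totalCurvature_eq] at h
  have hL := hX.length_pos
  rw [isoperimetricDeficit]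
  convert h using 2
  · funext u
    rw [curvatureDeviation, totalCurvature_eq]
    ring
  · field_simp
    ring

/-! ### Isoperimetric inequality, curvature estimate, integrality of the rotation number. -/

/-- The isoperimetric inequality. -/
theorem isoperimetric (hX : IsClosedCurve X) : 4 * Real.pi * area X ≤ length X ^ 2 := by
  have h := hurwitz hX.continuous_deriv.norm hX.speed_pos
    (fun u => by simp only [hX.deriv_periodic]) hX.hasDerivAt hX.continuous_deriv
    (by simpa using hX.periodic 0)
  have h1 : ∀ u, ‖deriv X u‖ ^ 2 / ‖deriv X u‖ = ‖deriv X u‖ := fun u => by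
    rw [sq, mul_div_cancel_right₀ _ (hX.speed_pos u).ne']
  have h2 : ∀ u, inner ℝ (Complex.I * X u) (deriv X u) =
      -(inner ℝ (X u) (normal X u) * ‖deriv X u‖) := fun u => by
    nth_rewrite 1 [← hX.speed_smul_tangent u]
    rw [real_inner_smul_right, normal]
    simp only [Complex.inner, Complex.mul_re, Complex.conj_re, Complex.conj_im, Complex.mul_im,
      Complex.I_re, Complex.I_im]
    ring
  simp only [h1, h2, ← length_eq, intervalIntegral.integral_neg] at h
  have h3 := arcIntegral_inner_normal (X := X)
  rw [arcIntegral] at h3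
  rw [h3] at h
  linarith

/-- The lower bound for the deviation of the curvature in terms of the isoperimetric deficit. -/
theorem neg_isoperimetricDeficit_le (hX : IsClosedCurve X) :
    -(4 * Real.pi ^ 2 * rotationNumber X * isoperimetricDeficit X) ≤
      length X * arcIntegral X (fun u => curvatureDeviation X u ^ 2) := by
  have hL := hX.length_pos
  have hpi := Real.pi_pos
  set n := rotationNumber X with hn
  set L := length X with hLdef
  -- Chosen so that n/c is the mean curvature 2πn/L, whence cκ − n = cκ̃.
  set c : ℝ := L / (2 * Real.pi) with hc
  have hc0 : 0 < c := by positivity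
  have hdev : ∀ u, c * curvature X u - n = c * curvatureDeviation X u := fun u => by
    rw [curvatureDeviation, totalCurvature_eq, ← hn, ← hLdef, hc]
    field_simp
  -- The curve −cν − nX has arc-length derivative (cκ − n)τ = cκ̃τ, because ∂_sν = −κτ.
  have hw : ∀ u, HasDerivAt (fun u => -(Complex.I * (c • tangent X u)) - n • X u)
      ((c * curvatureDeviation X u) • deriv X u) u := fun u => by
    refine HasDerivAt.congr_deriv ((((hX.hasDerivAt_tangent u).const_smul c).const_mul
      Complex.I).neg.sub ((hX.hasDerivAt u).const_smul n)) ?_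
    rw [← hdev]
    nth_rewrite 2 3 [← hX.speed_smul_tangent u]
    simp only [Complex.real_smul, normal]
    push_cast
    linear_combination
      (-(c : ℂ) * curvature X u * ‖deriv X u‖ * tangent X u) * Complex.I_mul_I
  have hcont : Continuous fun u => (c * curvatureDeviation X u) • deriv X u :=
    (continuous_const.mul hX.continuous_curvatureDeviation).smul hX.continuous_deriv
  have h := hurwitz hX.continuous_deriv.norm hX.speed_pos
    (fun u => by simp only [hX.deriv_periodic]) hw hcont
    (by
      have h1 := hX.periodic 0
      have h2 := hX.tangent_periodic 0
      rw [zero_add] at h1 h2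
      simp only [h1, h2])
  rw [← length_eq, ← hLdef] at h
  have h1 : ∀ u, ‖(c * curvatureDeviation X u) • deriv X u‖ ^ 2 / ‖deriv X u‖ =
      c ^ 2 * curvatureDeviation X u ^ 2 * ‖deriv X u‖ := fun u => by
    have := hX.speed_pos u
    rw [norm_smul, Real.norm_eq_abs, mul_pow, sq_abs]
    field_simp
  have h2 : ∀ u, inner ℝ (Complex.I * (-(Complex.I * (c • tangent X u)) - n • X u))
      ((c * curvatureDeviation X u) • deriv X u) =
      (c ^ 2 * curvatureDeviation X u +
        c * n * (curvatureDeviation X u * inner ℝ (X u) (normal X u))) *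
        ‖deriv X u‖ := fun u => by
    have e : Complex.I * (-(Complex.I * (c • tangent X u)) - n • X u) =
        c • tangent X u - n • (Complex.I * X u) := by
      simp only [Complex.real_smul]
      linear_combination (-(c : ℂ) * tangent X u) * Complex.I_mul_I
    have e2 : inner ℝ (Complex.I * X u) (tangent X u) = -inner ℝ (X u) (normal X u) := by
      rw [normal]
      simp only [Complex.inner, Complex.mul_re, Complex.conj_re, Complex.conj_im, Complex.mul_im,
        Complex.I_re, Complex.I_im]
      ring
    nth_rewrite 1 [e, ← hX.speed_smul_tangent u]
    simp only [real_inner_smul_right, inner_sub_left, real_inner_smul_left, e2,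
      real_inner_self_eq_norm_sq, hX.norm_tangent]
    ring
  simp only [h1, h2] at h
  change 2 * Real.pi * arcIntegral X (fun u => c ^ 2 * curvatureDeviation X u +
        c * n * (curvatureDeviation X u * inner ℝ (X u) (normal X u))) ≤
      L * arcIntegral X (fun u => c ^ 2 * curvatureDeviation X u ^ 2) at h
  have hcd := hX.continuous_curvatureDeviation
  rw [hX.arcIntegral_add (by fun_prop)
    (by have := hX.continuous; have := hX.continuous_normal; fun_prop),
    arcIntegral_const_mul, arcIntegral_const_mul, arcIntegral_const_mul,
    hX.arcIntegral_curvatureDeviation, hX.arcIntegral_curvatureDeviation_mul_inner_normal] at h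
  have hLc : L = 2 * Real.pi * c := by rw [hc]; field_simp
  rw [← hLdef, mul_zero, zero_add] at h
  have h3 : c ^ 2 * -(4 * Real.pi ^ 2 * n * isoperimetricDeficit X) ≤
      c ^ 2 * (L * arcIntegral X fun u => curvatureDeviation X u ^ 2) := by
    have h4 : c ^ 2 * -(4 * Real.pi ^ 2 * n * isoperimetricDeficit X) =
        2 * Real.pi * (c * n * -(L * isoperimetricDeficit X)) := by
      rw [hLc]
      ring
    linarith
  exact le_of_mul_le_mul_left h3 (by positivity)

/-- The rotation number is an integer. -/
theorem exists_rotationNumber_eq (hX : IsClosedCurve X) : ∃ k : ℤ, rotationNumber X = k := by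
  have hk : Continuous fun u => curvature X u * ‖deriv X u‖ :=
    hX.continuous_curvature.mul hX.continuous_deriv.norm
  set θ : ℝ → ℝ := fun u => ∫ x in (0 : ℝ)..u, curvature X x * ‖deriv X x‖ with hθ
  have hθd : ∀ u, HasDerivAt θ (curvature X u * ‖deriv X u‖) u := fun u =>
    (hk.integral_hasStrictDerivAt 0 u).hasDerivAt
  -- θ is the tangent angle: e^{−iθ}τ is constant. Since τ is periodic, the total curvature θ(1)
  -- lies in 2πℤ.
  have hd : ∀ u, HasDerivAt (fun u => Complex.exp (-(θ u * Complex.I)) * tangent X u) 0 u := by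
    intro u
    refine HasDerivAt.congr_deriv ((((hθd u).ofReal_comp.mul_const Complex.I).neg.cexp).mul
      (hX.hasDerivAt_tangent u)) ?_
    rw [normal, Complex.real_smul]
    push_cast
    ring
  have hc := is_const_of_deriv_eq_zero (fun u => (hd u).differentiableAt) (fun u => (hd u).deriv)
    1 0
  have h0 : θ 0 = 0 := by simp [hθ]
  have h1 : θ 1 = totalCurvature X := rfl
  have h2 := hX.tangent_periodic 0
  rw [zero_add] at h2
  have hne : tangent X 0 ≠ 0 := by
    rw [← norm_ne_zero_iff, hX.norm_tangent]
    exact one_ne_zero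
  rw [h2] at hc
  have h3 := mul_right_cancel₀ hne hc
  rw [h0, h1, Complex.ofReal_zero, zero_mul, neg_zero, Complex.exp_zero,
    Complex.exp_eq_one_iff] at h3
  obtain ⟨m, hm⟩ := h3
  refine ⟨-m, ?_⟩
  have h4 := congrArg Complex.im hm
  simp at h4
  rw [rotationNumber, div_eq_iff (by positivity)]
  push_cast
  linarith

end IsClosedCurve

/-! ### Differentiation in time of integrals along the curve. -/

open Filter Topology

/-- The time interval `[0, T)`. -/
def timeInterval (T : EReal) : Set ℝ := {t | 0 ≤ t ∧ (t : EReal) < T}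

theorem ordConnected_timeInterval (T : EReal) : (timeInterval T).OrdConnected :=
  ⟨fun _ hx _ hy _ hz =>
    ⟨hx.1.trans hz.1, (EReal.coe_le_coe_iff.2 hz.2).trans_lt hy.2⟩⟩

theorem Icc_subset_timeInterval {T : EReal} {t : ℝ} (ht : t ∈ timeInterval T) :
    Set.Icc 0 t ⊆ timeInterval T := fun _ hx =>
  ⟨hx.1, (EReal.coe_le_coe_iff.2 hx.2).trans_lt ht.2⟩

theorem timeInterval_mem_nhds {T : EReal} {t : ℝ} (h0 : 0 < t) (hT : (t : EReal) < T) :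
    timeInterval T ∈ 𝓝 t := by
  have h : {x : ℝ | (x : EReal) < T} ∈ 𝓝 t :=
    (isOpen_lt continuous_coe_real_ereal continuous_const).mem_nhds hT
  filter_upwards [h, lt_mem_nhds h0] with x hx hx0 using ⟨hx0.le, hx⟩

/-- Integrals of difference quotients against a continuous family converge. -/
theorem tendsto_integral_inner_slope {S : Set ℝ} {t₀ : ℝ} (hS : S ∈ 𝓝 t₀) {a f g : ℝ → ℝ → ℂ}
    (hf : ∀ t ∈ S, Continuous (f t))
    (hfg : ∀ᶠ t in 𝓝 t₀, ∀ u, HasDerivAt (fun t' => f t' u) (g t u) t)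
    (hg : Continuous fun p : S × ℝ => g p.1 p.2)
    (ha : Continuous fun p : S × ℝ => a p.1 p.2) :
    Tendsto (fun t => ∫ u in (0 : ℝ)..1, inner ℝ (a t u) (slope (fun t' => f t' u) t₀ t))
      (𝓝[≠] t₀) (𝓝 (∫ u in (0 : ℝ)..1, inner ℝ (a t₀ u) (g t₀ u))) := by
  obtain ⟨δ, hδ, hball⟩ := Metric.nhds_basis_closedBall.mem_iff.1 (inter_mem hS hfg)
  rw [Real.closedBall_eq_Icc] at hball
  set K : Set ℝ := Set.Icc (t₀ - δ) (t₀ + δ) with hK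
  have hKn : K ∈ 𝓝 t₀ := Icc_mem_nhds (by linarith) (by linarith)
  have ht₀ : t₀ ∈ K := mem_of_mem_nhds hKn
  have hKS : K ⊆ S := fun t ht => (hball ht).1
  have bdd : ∀ b : ℝ → ℝ → ℂ, Continuous (fun p : S × ℝ => b p.1 p.2) →
      ∃ C, ∀ t ∈ K, ∀ u ∈ Set.Icc (0 : ℝ) 1, ‖b t u‖ ≤ C := by
    intro b hb
    have hbc : ContinuousOn (fun p : ℝ × ℝ => b p.1 p.2) (K ×ˢ Set.Icc 0 1) := by
      rw [continuousOn_iff_continuous_domRestrict]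
      exact hb.comp (f := fun p : K ×ˢ Set.Icc (0 : ℝ) 1 =>
        ((⟨p.1.1, hKS p.2.1⟩ : S), p.1.2)) (by fun_prop)
    obtain ⟨C, hC⟩ := (isCompact_Icc.prod isCompact_Icc).exists_bound_of_continuousOn hbc
    exact ⟨C, fun t ht u hu => hC (t, u) ⟨ht, hu⟩⟩
  obtain ⟨M, hM⟩ := bdd g hg
  obtain ⟨N, hN⟩ := bdd a ha
  have hM0 : 0 ≤ M := (norm_nonneg _).trans (hM t₀ ht₀ 0 (by simp))
  have hacont : ∀ t ∈ S, Continuous (a t) := fun t ht =>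
    ha.comp (f := fun u : ℝ => ((⟨t, ht⟩ : S), u)) (by fun_prop)
  refine intervalIntegral.tendsto_integral_filter_of_dominated_convergence (fun _ => N * M)
    ?_ ?_ (intervalIntegrable_const) ?_
  · filter_upwards [mem_nhdsWithin_of_mem_nhds hS] with t ht
    refine Continuous.aestronglyMeasurable ((hacont t ht).inner ?_)
    simp only [slope, vsub_eq_sub]
    exact ((hf t ht).sub (hf t₀ (hKS ht₀))).const_smul _
  · filter_upwards [mem_nhdsWithin_of_mem_nhds hKn, self_mem_nhdsWithin] with t ht hne
    refine Eventually.of_forall fun u hu => ?_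
    rw [Set.uIoc_of_le zero_le_one] at hu
    have hu' : u ∈ Set.Icc (0 : ℝ) 1 := ⟨hu.1.le, hu.2⟩
    -- The mean value inequality bounds the difference quotients uniformly by the supremum of the
    -- velocity, which provides the dominating constant.
    have hs : ‖slope (fun t' => f t' u) t₀ t‖ ≤ M := by
      have h := (convex_Icc (t₀ - δ) (t₀ + δ)).norm_image_sub_le_of_norm_hasDerivWithin_le
        (f := fun t' => f t' u) (f' := fun t' => g t' u) (C := M)
        (fun x hx => ((hball hx).2 u).hasDerivWithinAt) (fun x hx => hM x hx u hu') ht₀ ht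
      rw [slope, vsub_eq_sub, norm_smul, norm_inv, inv_mul_le_iff₀
        (norm_pos_iff.2 (sub_ne_zero.2 hne)), mul_comm]
      exact h
    exact (norm_inner_le_norm _ _).trans
      (mul_le_mul (hN t ht u hu') hs (norm_nonneg _) ((norm_nonneg _).trans (hN t ht u hu')))
  · refine Eventually.of_forall fun u _ => Tendsto.inner ?_ ?_
    · have : ContinuousOn (fun t => a t u) S := by
        rw [continuousOn_iff_continuous_domRestrict]
        exact ha.comp (f := fun t : S => (t, u)) (by fun_prop)
      exact (this.continuousAt hS).tendsto.mono_left nhdsWithin_le_nhds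
    · exact hasDerivAt_iff_tendsto_slope.1 (hfg.self_of_nhds u)

namespace IsClosedCurve

/-- The first variation inequality for the length, from the convexity of the norm. -/
theorem neg_integral_le_length_sub {X Y : ℝ → ℂ} (hX : IsClosedCurve X) (hY : IsClosedCurve Y) :
    -∫ u in (0 : ℝ)..1, inner ℝ (deriv (tangent X) u) (Y u - X u) ≤ length Y - length X := by
  have hX0 := hX.continuous
  have hY0 := hY.continuous
  have hX1 := hX.continuous_deriv
  have hY1 := hY.continuous_deriv
  have hτ := hX.continuous_tangent
  have hτ' : Continuous (deriv (tangent X)) := hX.contDiff_tangent.continuous_deriv le_rfl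
  -- Integration by parts moves the u-derivative off Y − X, so that later only the t-derivative of f
  -- itself is needed.
  have h : ∫ u in (0 : ℝ)..1, (inner ℝ (tangent X u) (deriv Y u - deriv X u) +
      inner ℝ (deriv (tangent X) u) (Y u - X u)) = 0 := by
    rw [intervalIntegral.integral_eq_sub_of_hasDerivAt
      (f := fun u => inner ℝ (tangent X u) (Y u - X u))
      (fun u _ => ((hX.contDiff_tangent.differentiable (by norm_num)) u).hasDerivAt.inner ℝ
        ((hY.hasDerivAt u).sub (hX.hasDerivAt u)))
      (Continuous.intervalIntegrable (by fun_prop) _ _)]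
    have h1 := hX.periodic 0
    have h2 := hX.tangent_periodic 0
    have h3 := hY.periodic 0
    rw [zero_add] at h1 h2 h3
    rw [h1, h2, h3, sub_self]
  rw [intervalIntegral.integral_add (Continuous.intervalIntegrable (by fun_prop) _ _)
    (Continuous.intervalIntegrable (by fun_prop) _ _)] at h
  rw [← eq_neg_iff_add_eq_zero.2 h, length_eq, length_eq, ← intervalIntegral.integral_sub
    (Continuous.intervalIntegrable (by fun_prop) _ _)
    (Continuous.intervalIntegrable (by fun_prop) _ _)]
  refine intervalIntegral.integral_mono_on zero_le_one
    (Continuous.intervalIntegrable (by fun_prop) _ _)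
    (Continuous.intervalIntegrable (by fun_prop) _ _) fun u _ => ?_
  have h1 := real_inner_le_norm (tangent X u) (deriv Y u)
  have h2 : inner ℝ (tangent X u) (deriv X u) = ‖deriv X u‖ := by
    nth_rewrite 1 [← hX.speed_smul_tangent u]
    rw [real_inner_smul_right, real_inner_self_eq_norm_sq, hX.norm_tangent]
    ring
  rw [hX.norm_tangent, one_mul] at h1
  rw [inner_sub_right, h2]
  linarith

theorem area_eq {X : ℝ → ℂ} (hX : IsClosedCurve X) :
    area X = -(1 / 2) * ∫ u in (0 : ℝ)..1, inner ℝ (Complex.I * deriv X u) (X u) := by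
  rw [area, arcIntegral]
  congr 2
  funext u
  nth_rewrite 2 [← hX.speed_smul_tangent u]
  rw [mul_smul_comm, real_inner_smul_left, real_inner_comm, normal, mul_comm]

/-- The difference of two signed areas. -/
theorem area_sub {X Y : ℝ → ℂ} (hX : IsClosedCurve X) (hY : IsClosedCurve Y) :
    area Y - area X = -(1 / 2) * ∫ u in (0 : ℝ)..1,
      inner ℝ (Complex.I * (deriv X u + deriv Y u)) (Y u - X u) := by
  have hX0 := hX.continuous
  have hY0 := hY.continuous
  have hX1 := hX.continuous_deriv
  have hY1 := hY.continuous_deriv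
  have h : ∫ u in (0 : ℝ)..1, (inner ℝ (Complex.I * X u) (deriv Y u) +
      inner ℝ (Complex.I * deriv X u) (Y u)) = 0 := by
    rw [intervalIntegral.integral_eq_sub_of_hasDerivAt
      (f := fun u => inner ℝ (Complex.I * X u) (Y u))
      (fun u _ => ((hX.hasDerivAt u).const_mul _).inner ℝ (hY.hasDerivAt u))
      (Continuous.intervalIntegrable (by fun_prop) _ _)]
    have h1 := hX.periodic 0
    have h3 := hY.periodic 0
    rw [zero_add] at h1 h3
    rw [h1, h3, sub_self]
  -- Area is a quadratic form; the cross terms add up to the derivative of ⟨iX, Y⟩ and integrate to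
  -- zero.
  have e : ∀ u, inner ℝ (Complex.I * (deriv X u + deriv Y u)) (Y u - X u) =
      inner ℝ (Complex.I * deriv Y u) (Y u) - inner ℝ (Complex.I * deriv X u) (X u) +
        (inner ℝ (Complex.I * X u) (deriv Y u) + inner ℝ (Complex.I * deriv X u) (Y u)) :=
    fun u => by
      simp only [Complex.inner, Complex.mul_re, Complex.conj_re, Complex.conj_im, Complex.mul_im,
        Complex.I_re, Complex.I_im, Complex.add_re, Complex.add_im, Complex.sub_re,
        Complex.sub_im]
      ring
  simp only [e]
  rw [intervalIntegral.integral_add (Continuous.intervalIntegrable (by fun_prop) _ _)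
    (Continuous.intervalIntegrable (by fun_prop) _ _), h,
    intervalIntegral.integral_sub (Continuous.intervalIntegrable (by fun_prop) _ _)
    (Continuous.intervalIntegrable (by fun_prop) _ _), hX.area_eq, hY.area_eq]
  ring

end IsClosedCurve

/-! ### Evolution of rotation number, area and length. -/

namespace IsClassicalSolution

variable {F : Flow} {T : EReal} {f : ℝ → ℝ → ℂ}

theorem isClosedCurve (hf : IsClassicalSolution F T f) {t : ℝ} (ht : t ∈ timeInterval T) :
    IsClosedCurve (f t) :=
  ⟨hf.contDiff t ht.1 ht.2, hf.periodic t ht.1 ht.2, hf.immersed t ht.1 ht.2⟩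

theorem continuous_position (hf : IsClassicalSolution F T f) :
    Continuous fun p : timeInterval T × ℝ => f p.1 p.2 :=
  hf.continuousOn.comp_continuous (f := fun p : timeInterval T × ℝ => ((p.1 : ℝ), p.2))
    (by fun_prop) fun p => p.1.2

theorem continuous_deriv (hf : IsClassicalSolution F T f) :
    Continuous fun p : timeInterval T × ℝ => deriv (f p.1) p.2 :=
  hf.continuousOn_deriv.comp_continuous (f := fun p : timeInterval T × ℝ => ((p.1 : ℝ), p.2))
    (by fun_prop) fun p => p.1.2

theorem continuous_deriv_two (hf : IsClassicalSolution F T f) :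
    Continuous fun p : timeInterval T × ℝ => iteratedDeriv 2 (f p.1) p.2 :=
  hf.continuousOn_deriv_two.comp_continuous (f := fun p : timeInterval T × ℝ => ((p.1 : ℝ), p.2))
    (by fun_prop) fun p => p.1.2

theorem speed_ne_zero (hf : IsClassicalSolution F T f) (p : timeInterval T × ℝ) :
    ‖deriv (f p.1) p.2‖ ≠ 0 :=
  ((hf.isClosedCurve p.1.2).speed_pos p.2).ne'

theorem continuous_normal (hf : IsClassicalSolution F T f) :
    Continuous fun p : timeInterval T × ℝ => normal (f p.1) p.2 :=
  continuous_const.mul ((hf.continuous_deriv.norm.inv₀ hf.speed_ne_zero).smul hf.continuous_deriv)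

theorem continuous_curvature (hf : IsClassicalSolution F T f) :
    Continuous fun p : timeInterval T × ℝ => curvature (f p.1) p.2 := by
  simp only [fun p : timeInterval T × ℝ => (hf.isClosedCurve p.1.2).curvature_eq p.2]
  exact (hf.continuous_deriv_two.inner (continuous_const.mul hf.continuous_deriv)).div
    (hf.continuous_deriv.norm.pow 3) fun p => pow_ne_zero 3 (hf.speed_ne_zero p)

theorem continuous_arcIntegral (hf : IsClassicalSolution F T f) {φ : ℝ → ℝ → ℝ}
    (hφ : Continuous fun p : timeInterval T × ℝ => φ p.1 p.2) :
    Continuous fun t : timeInterval T => arcIntegral (f t) (φ t) :=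
  intervalIntegral.continuous_parametric_intervalIntegral_of_continuous'
    (f := fun (t : timeInterval T) u => φ t u * ‖deriv (f t) u‖)
    (hφ.mul hf.continuous_deriv.norm) 0 1

theorem continuous_length (hf : IsClassicalSolution F T f) :
    Continuous fun t : timeInterval T => length (f t) :=
  hf.continuous_arcIntegral (φ := fun _ _ => 1) continuous_const

theorem continuous_totalCurvature (hf : IsClassicalSolution F T f) :
    Continuous fun t : timeInterval T => totalCurvature (f t) :=
  hf.continuous_arcIntegral (φ := fun t => curvature (f t)) hf.continuous_curvature

theorem continuous_area (hf : IsClassicalSolution F T f) :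
    Continuous fun t : timeInterval T => area (f t) :=
  continuous_const.mul (hf.continuous_arcIntegral
    (φ := fun t u => inner ℝ (f t u) (normal (f t) u))
    (hf.continuous_position.inner hf.continuous_normal))

theorem length_ne_zero (hf : IsClassicalSolution F T f) (t : timeInterval T) :
    length (f t) ≠ 0 :=
  (hf.isClosedCurve t.2).length_pos.ne'

theorem continuous_curvatureDeviation (hf : IsClassicalSolution F T f) :
    Continuous fun p : timeInterval T × ℝ => curvatureDeviation (f p.1) p.2 :=
  hf.continuous_curvature.sub
    ((hf.continuous_totalCurvature.div hf.continuous_length hf.length_ne_zero).comp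
      continuous_fst)

theorem continuous_nonlocalTerm (hf : IsClassicalSolution F T f) :
    Continuous fun t : timeInterval T => nonlocalTerm F (f t) := by
  have hd := fun t : timeInterval T => hf.defined t t.2.1 t.2.2
  cases F with
  | AP => exact continuous_const
  | LP =>
    exact (hf.continuous_length.mul (hf.continuous_totalCurvature.inv₀ hd)).mul
      (hf.continuous_arcIntegral (φ := fun t u => curvatureDeviation (f t) u ^ 2)
        (hf.continuous_curvatureDeviation.pow 2))
  | JP =>
    exact ((hf.continuous_length.pow 2).div (continuous_const.mul hf.continuous_area)
      fun t => mul_ne_zero two_ne_zero (hd t)).sub hf.continuous_totalCurvature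

/-- The velocity of the flow is jointly continuous. -/
theorem continuous_velocity (hf : IsClassicalSolution F T f) :
    Continuous fun p : timeInterval T × ℝ =>
      (curvatureDeviation (f p.1) p.2 - nonlocalTerm F (f p.1) / length (f p.1)) •
        normal (f p.1) p.2 :=
  (hf.continuous_curvatureDeviation.sub
    ((hf.continuous_nonlocalTerm.div hf.continuous_length hf.length_ne_zero).comp
      continuous_fst)).smul hf.continuous_normal

theorem eventually_hasDerivAt (hf : IsClassicalSolution F T f) {t : ℝ} (h0 : 0 < t)
    (hT : (t : EReal) < T) : ∀ᶠ t' in 𝓝 t, ∀ u, HasDerivAt (fun s => f s u)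
      ((curvatureDeviation (f t') u - nonlocalTerm F (f t') / length (f t')) •
        normal (f t') u) t' := by
  filter_upwards [timeInterval_mem_nhds h0 hT, lt_mem_nhds h0] with t' h1 h2
  exact hf.equation t' h2 h1.2

/-- An integer-valued continuous function on an interval is constant. -/
theorem rotationNumber_eq (hf : IsClassicalSolution F T f) {t : ℝ} (ht : t ∈ timeInterval T) :
    rotationNumber (f t) = rotationNumber (f 0) := by
  choose k hk using fun s : timeInterval T => (hf.isClosedCurve s.2).exists_rotationNumber_eq
  have hkc : Continuous k := by
    rw [Int.isClosedEmbedding_coe_real.isEmbedding.continuous_iff]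
    simp only [Function.comp_def, ← hk]
    exact hf.continuous_totalCurvature.div_const _
  have hp : PreconnectedSpace (timeInterval T) :=
    isPreconnected_iff_preconnectedSpace.1 (ordConnected_timeInterval T).isPreconnected
  have h0 : (0 : ℝ) ∈ timeInterval T := ⟨le_rfl, by simpa using hf.pos⟩
  rw [hk ⟨t, ht⟩, hk ⟨0, h0⟩, hp.constant hkc (x := ⟨t, ht⟩) (y := ⟨0, h0⟩)]

/-- The evolution of the signed area. -/
theorem hasDerivAt_area (hf : IsClassicalSolution F T f) {t : ℝ} (h0 : 0 < t)
    (hT : (t : EReal) < T) :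
    HasDerivAt (fun s => area (f s)) (nonlocalTerm F (f t)) t := by
  have hS := timeInterval_mem_nhds h0 hT
  have ht : t ∈ timeInterval T := ⟨h0.le, hT⟩
  have hX := hf.isClosedCurve ht
  have hlim := tendsto_integral_inner_slope hS
    (a := fun s u => Complex.I * (deriv (f t) u + deriv (f s) u))
    (fun s hs => (hf.isClosedCurve hs).continuous) (hf.eventually_hasDerivAt h0 hT)
    hf.continuous_velocity (continuous_const.mul
      ((hX.continuous_deriv.comp continuous_snd).add hf.continuous_deriv))
  rw [hasDerivAt_iff_tendsto_slope]
  have hval : -(1 / 2) * ∫ u in (0 : ℝ)..1, inner ℝ (Complex.I * (deriv (f t) u + deriv (f t) u))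
      ((curvatureDeviation (f t) u - nonlocalTerm F (f t) / length (f t)) • normal (f t) u) =
      nonlocalTerm F (f t) := by
    have hL := hX.length_pos
    have h1 : ∀ u, inner ℝ (Complex.I * (deriv (f t) u + deriv (f t) u))
        ((curvatureDeviation (f t) u - nonlocalTerm F (f t) / length (f t)) • normal (f t) u) =
        2 * (curvatureDeviation (f t) u + -(nonlocalTerm F (f t) / length (f t))) *
          ‖deriv (f t) u‖ := fun u => by
      have : Complex.I * (deriv (f t) u + deriv (f t) u) =
          (2 * ‖deriv (f t) u‖) • normal (f t) u := by
        nth_rewrite 1 2 [← hX.speed_smul_tangent u]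
        rw [normal, Complex.real_smul, Complex.real_smul]
        push_cast
        ring
      rw [this, real_inner_smul_right, real_inner_smul_left, real_inner_self_eq_norm_sq,
        hX.norm_normal]
      ring
    simp only [h1]
    change -(1 / 2) * arcIntegral (f t) _ = _
    rw [IsClosedCurve.arcIntegral_const_mul, hX.arcIntegral_add hX.continuous_curvatureDeviation
      continuous_const, hX.arcIntegral_curvatureDeviation, IsClosedCurve.arcIntegral_const]
    field_simp
    ring
  rw [← hval]
  refine (hlim.const_mul (-(1 / 2))).congr' ?_
  filter_upwards [mem_nhdsWithin_of_mem_nhds hS] with s hs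
  rw [slope, vsub_eq_sub, hX.area_sub (hf.isClosedCurve hs), smul_eq_mul, mul_left_comm]
  congr 1
  rw [← intervalIntegral.integral_const_mul]
  simp only [slope, vsub_eq_sub, real_inner_smul_right]

/-- The evolution of the length. -/
theorem hasDerivAt_length (hf : IsClassicalSolution F T f) {t : ℝ} (h0 : 0 < t)
    (hT : (t : EReal) < T) :
    HasDerivAt (fun s => length (f s))
      (nonlocalTerm F (f t) * totalCurvature (f t) / length (f t) -
        arcIntegral (f t) (fun u => curvatureDeviation (f t) u ^ 2)) t := by
  have hS := timeInterval_mem_nhds h0 hT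
  have ht : t ∈ timeInterval T := ⟨h0.le, hT⟩
  have hX := hf.isClosedCurve ht
  have hcont : Continuous fun p : timeInterval T × ℝ => deriv (tangent (f p.1)) p.2 := by
    simp only [fun p : timeInterval T × ℝ => (hf.isClosedCurve p.1.2).deriv_tangent p.2]
    exact (hf.continuous_curvature.mul hf.continuous_deriv.norm).smul hf.continuous_normal
  -- The two convexity bounds pair the difference quotient with ∂_uτ at time t and at time s; both
  -- have the same limit as s → t.
  have hlim₁ := (tendsto_integral_inner_slope hS (a := fun _ u => deriv (tangent (f t)) u)
    (fun s hs => (hf.isClosedCurve hs).continuous) (hf.eventually_hasDerivAt h0 hT)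
    hf.continuous_velocity
    ((hX.contDiff_tangent.continuous_deriv le_rfl).comp continuous_snd)).neg
  have hlim₂ := (tendsto_integral_inner_slope hS (a := fun s u => deriv (tangent (f s)) u)
    (fun s hs => (hf.isClosedCurve hs).continuous) (hf.eventually_hasDerivAt h0 hT)
    hf.continuous_velocity hcont).neg
  have hval : -∫ u in (0 : ℝ)..1, inner ℝ (deriv (tangent (f t)) u)
      ((curvatureDeviation (f t) u - nonlocalTerm F (f t) / length (f t)) • normal (f t) u) =
      nonlocalTerm F (f t) * totalCurvature (f t) / length (f t) -
        arcIntegral (f t) (fun u => curvatureDeviation (f t) u ^ 2) := by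
    have hL := hX.length_pos
    have h1 : ∀ u, inner ℝ (deriv (tangent (f t)) u)
        ((curvatureDeviation (f t) u - nonlocalTerm F (f t) / length (f t)) • normal (f t) u) =
        (curvature (f t) u * curvatureDeviation (f t) u +
          -(nonlocalTerm F (f t) / length (f t)) * curvature (f t) u) *
          ‖deriv (f t) u‖ := fun u => by
      rw [hX.deriv_tangent, real_inner_smul_right, real_inner_smul_left,
        real_inner_self_eq_norm_sq, hX.norm_normal]
      ring
    have hk := hX.continuous_curvature
    have hd := hX.continuous_curvatureDeviation
    simp only [h1]
    change -arcIntegral (f t) (fun u => curvature (f t) u * curvatureDeviation (f t) u +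
          -(nonlocalTerm F (f t) / length (f t)) * curvature (f t) u) = _
    rw [hX.arcIntegral_add (by fun_prop) (by fun_prop), IsClosedCurve.arcIntegral_const_mul,
      hX.arcIntegral_curvature_mul_curvatureDeviation, totalCurvature]
    ring
  rw [hval] at hlim₁ hlim₂
  rw [hasDerivAt_iff_tendsto_slope]
  -- Dividing by s − t swaps the two bounds when s < t; min and max treat both signs at once.
  have hmin := hlim₁.min hlim₂
  have hmax := hlim₁.max hlim₂
  rw [min_self] at hmin
  rw [max_self] at hmax
  have key : ∀ s ∈ timeInterval T, ∀ b : ℝ → ℂ,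
      -∫ u in (0 : ℝ)..1, inner ℝ (b u) (slope (fun t' => f t' u) t s) =
        (s - t)⁻¹ * -∫ u in (0 : ℝ)..1, inner ℝ (b u) (f s u - f t u) := fun s hs b => by
    rw [mul_neg, ← intervalIntegral.integral_const_mul]
    simp only [slope, vsub_eq_sub, real_inner_smul_right]
  have bounds : ∀ s ∈ timeInterval T,
      -∫ u in (0 : ℝ)..1, inner ℝ (deriv (tangent (f t)) u) (f s u - f t u) ≤
        length (f s) - length (f t) ∧
      length (f s) - length (f t) ≤
        -∫ u in (0 : ℝ)..1, inner ℝ (deriv (tangent (f s)) u) (f s u - f t u) := fun s hs => by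
    refine ⟨hX.neg_integral_le_length_sub (hf.isClosedCurve hs), ?_⟩
    have h := (hf.isClosedCurve hs).neg_integral_le_length_sub hX
    have h2 : ∀ u, inner ℝ (deriv (tangent (f s)) u) (f t u - f s u) =
        -inner ℝ (deriv (tangent (f s)) u) (f s u - f t u) := fun u => by
      rw [← inner_neg_right, neg_sub]
    simp only [h2, intervalIntegral.integral_neg] at h
    linarith
  refine tendsto_of_tendsto_of_tendsto_of_le_of_le' hmin hmax ?_ ?_ <;>
  · filter_upwards [mem_nhdsWithin_of_mem_nhds hS] with s hs
    obtain ⟨hb₁, hb₂⟩ := bounds s hs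
    rw [key s hs, key s hs, slope, vsub_eq_sub, smul_eq_mul]
    rcases le_total t s with h | h
    · have hp : 0 ≤ (s - t)⁻¹ := inv_nonneg.2 (sub_nonneg.2 h)
      first
      | exact min_le_of_left_le (mul_le_mul_of_nonneg_left hb₁ hp)
      | exact le_max_of_le_right (mul_le_mul_of_nonneg_left hb₂ hp)
    · have hp : (s - t)⁻¹ ≤ 0 := inv_nonpos.2 (sub_nonpos.2 h)
      first
      | exact min_le_of_right_le (mul_le_mul_of_nonpos_left hb₂ hp)
      | exact le_max_of_le_left (mul_le_mul_of_nonpos_left hb₁ hp)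

end IsClassicalSolution

/-! ### Monotone quantities and linear growth of 4πnA − L². -/

theorem mul_le_sub_of_le_hasDerivAt {g g' : ℝ → ℝ} {C t : ℝ} (ht : 0 ≤ t)
    (hc : ContinuousOn g (Set.Icc 0 t)) (hd : ∀ s ∈ Set.Ioo 0 t, HasDerivAt g (g' s) s)
    (hC : ∀ s ∈ Set.Ioo 0 t, C ≤ g' s) : C * t ≤ g t - g 0 := by
  have h := (convex_Icc (0 : ℝ) t).mul_sub_le_image_sub_of_le_deriv (f := g) (C := C) hc
    (fun s hs => (hd s (by rwa [interior_Icc] at hs)).differentiableAt.differentiableWithinAt)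
    (fun s hs => by
      rw [interior_Icc] at hs
      rw [(hd s hs).deriv]
      exact hC s hs) 0 (Set.left_mem_Icc.2 ht) t (Set.right_mem_Icc.2 ht) ht
  rwa [sub_zero] at h

theorem IsClosedCurve.isoperimetricDeficit_eq {X : ℝ → ℂ} (hX : IsClosedCurve X) :
    isoperimetricDeficit X =
      -((4 * Real.pi * rotationNumber X * area X - length X ^ 2) / length X ^ 2) := by
  have := hX.length_pos
  rw [isoperimetricDeficit]
  field_simp
  ring

namespace IsClassicalSolution

variable {F : Flow} {T : EReal} {f : ℝ → ℝ → ℂ}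

theorem continuousOn_length (hf : IsClassicalSolution F T f) :
    ContinuousOn (fun t => length (f t)) (timeInterval T) :=
  continuousOn_iff_continuous_domRestrict.2 hf.continuous_length

theorem continuousOn_area (hf : IsClassicalSolution F T f) :
    ContinuousOn (fun t => area (f t)) (timeInterval T) :=
  continuousOn_iff_continuous_domRestrict.2 hf.continuous_area

/-- Along each of the flows, `4πnA - L²` has derivative `2 L ∫ κ̃² ds`. -/
theorem hasDerivAt_deficit (hf : IsClassicalSolution F T f) {t : ℝ} (h0 : 0 < t)
    (hT : (t : EReal) < T) :
    HasDerivAt (fun s => 4 * Real.pi * rotationNumber (f 0) * area (f s) - length (f s) ^ 2)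
      (2 * (length (f t) * arcIntegral (f t) (fun u => curvatureDeviation (f t) u ^ 2))) t := by
  have ht : t ∈ timeInterval T := ⟨h0.le, hT⟩
  have hL := (hf.isClosedCurve ht).length_pos
  refine (((hf.hasDerivAt_area h0 hT).const_mul _).sub
    ((hf.hasDerivAt_length h0 hT).pow 2)).congr_deriv ?_
  -- The terms in g cancel: 4πn·g − 2L·(2πn g/L) = 0.
  rw [IsClosedCurve.totalCurvature_eq, hf.rotationNumber_eq ht]
  field_simp
  ring

theorem continuousOn_deficit (hf : IsClassicalSolution F T f) :
    ContinuousOn (fun s => 4 * Real.pi * rotationNumber (f 0) * area (f s) - length (f s) ^ 2)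
      (timeInterval T) :=
  (continuousOn_const.mul hf.continuousOn_area).sub (hf.continuousOn_length.pow 2)

theorem deficit_zero_le (hf : IsClassicalSolution F T f) {t : ℝ} (ht : t ∈ timeInterval T) :
    4 * Real.pi * rotationNumber (f 0) * area (f 0) - length (f 0) ^ 2 ≤
      4 * Real.pi * rotationNumber (f 0) * area (f t) - length (f t) ^ 2 := by
  have hsub := Icc_subset_timeInterval ht
  have h := mul_le_sub_of_le_hasDerivAt (C := 0) ht.1 (hf.continuousOn_deficit.mono hsub)
    (fun s hs => hf.hasDerivAt_deficit hs.1 (hsub ⟨hs.1.le, hs.2.le⟩).2)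
    (fun s hs => mul_nonneg two_pos.le (mul_nonneg
      (hf.isClosedCurve (hsub ⟨hs.1.le, hs.2.le⟩)).length_pos.le
      (IsClosedCurve.arcIntegral_nonneg fun u => sq_nonneg _)))
  linarith

theorem length_le_length_zero (hf : IsClassicalSolution F T f) {t : ℝ} (ht : t ∈ timeInterval T)
    (hdec : ∀ s ∈ Set.Ioo 0 t, nonlocalTerm F (f s) * totalCurvature (f s) / length (f s) -
      arcIntegral (f s) (fun u => curvatureDeviation (f s) u ^ 2) ≤ 0) :
    length (f t) ≤ length (f 0) := by
  have hsub := Icc_subset_timeInterval ht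
  have h := mul_le_sub_of_le_hasDerivAt (C := 0) ht.1 (hf.continuousOn_length.mono hsub).neg
    (fun s hs => (hf.hasDerivAt_length hs.1 (hsub ⟨hs.1.le, hs.2.le⟩).2).neg)
    (fun s hs => neg_nonneg.2 (hdec s hs))
  simp only [Pi.neg_apply] at h
  linarith

/-- The linear growth of `4πnA - L²` along a flow that does not increase the length. -/
theorem mul_le_deficit_sub (hf : IsClassicalSolution F T f) {t : ℝ} (ht : t ∈ timeInterval T)
    (hn : 0 < rotationNumber (f 0)) (hI : isoperimetricDeficit (f 0) < 0)
    (hdec : ∀ s ∈ Set.Ioo 0 t, nonlocalTerm F (f s) * totalCurvature (f s) / length (f s) -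
      arcIntegral (f s) (fun u => curvatureDeviation (f s) u ^ 2) ≤ 0) :
    -8 * Real.pi ^ 2 * rotationNumber (f 0) * isoperimetricDeficit (f 0) * t ≤
      (4 * Real.pi * rotationNumber (f 0) * area (f t) - length (f t) ^ 2) -
        (4 * Real.pi * rotationNumber (f 0) * area (f 0) - length (f 0) ^ 2) := by
  have hsub := Icc_subset_timeInterval ht
  refine mul_le_sub_of_le_hasDerivAt ht.1 (hf.continuousOn_deficit.mono hsub)
    (fun s hs => hf.hasDerivAt_deficit hs.1 (hsub ⟨hs.1.le, hs.2.le⟩).2) fun s hs => ?_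
  have hs' : s ∈ timeInterval T := hsub ⟨hs.1.le, hs.2.le⟩
  have hX := hf.isClosedCurve hs'
  have hX0 := hf.isClosedCurve (hsub (Set.left_mem_Icc.2 ht.1))
  have hle := hf.length_le_length_zero hs' fun r hr => hdec r ⟨hr.1, hr.2.trans hs.2⟩
  have hD := hf.deficit_zero_le hs'
  have hL := hX.length_pos
  have hL0 := hX0.length_pos
  -- −I₋₁ is the quotient of the positive nondecreasing D by the nonincreasing L².
  have hIs : isoperimetricDeficit (f s) ≤ isoperimetricDeficit (f 0) := by
    have hI0 := hX0.isoperimetricDeficit_eq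
    rw [hX.isoperimetricDeficit_eq, hI0, hf.rotationNumber_eq hs', neg_le_neg_iff]
    have hD0 : 0 < 4 * Real.pi * rotationNumber (f 0) * area (f 0) - length (f 0) ^ 2 := by
      rw [hI0, neg_lt_zero] at hI
      exact (div_pos_iff_of_pos_right (by positivity)).1 hI
    gcongr
    exact hD0.le.trans hD
  have h := hX.neg_isoperimetricDeficit_le
  rw [hf.rotationNumber_eq hs'] at h
  have hpi := Real.pi_pos
  have := mul_le_mul_of_nonneg_left hIs
    (show 0 ≤ 8 * Real.pi ^ 2 * rotationNumber (f 0) by positivity)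
  linarith

end IsClassicalSolution

/-! ### Time bounds for the three flows. -/

theorem rotationNumber_pos {X : ℝ → ℂ} (hX : IsClosedCurve X) (hA : 0 < area X)
    (hI : isoperimetricDeficit X < 0) : 0 < rotationNumber X := by
  have hL := hX.length_pos
  have hpi := Real.pi_pos
  by_contra! hn
  have : 4 * Real.pi * rotationNumber X * area X / length X ^ 2 ≤ 0 :=
    div_nonpos_of_nonpos_of_nonneg (mul_nonpos_of_nonpos_of_nonneg
      (mul_nonpos_of_nonneg_of_nonpos (by positivity) hn) hA.le) (by positivity)
  rw [isoperimetricDeficit] at hI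
  linarith

namespace IsClassicalSolution

variable {T : EReal} {f : ℝ → ℝ → ℂ}

theorem zero_mem {F : Flow} (hf : IsClassicalSolution F T f) : (0 : ℝ) ∈ timeInterval T :=
  ⟨le_rfl, by simpa using hf.pos⟩

/-- The area is conserved, so D(t) − D(0) = L(0)² − L(t)² ≤ L(0)² − 4πA(0). -/
theorem time_le_of_AP (hf : IsClassicalSolution Flow.AP T f) (hA : 0 < area (f 0))
    (hI : isoperimetricDeficit (f 0) < 0) {t : ℝ} (ht : t ∈ timeInterval T) :
    t ≤ (length (f 0) ^ 2 - 4 * Real.pi * area (f 0)) /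
      (-8 * Real.pi ^ 2 * rotationNumber (f 0) * isoperimetricDeficit (f 0)) := by
  have hn := rotationNumber_pos (hf.isClosedCurve hf.zero_mem) hA hI
  have hsub := Icc_subset_timeInterval ht
  have hpi := Real.pi_pos
  have key := hf.mul_le_deficit_sub ht hn hI fun s hs => by
    rw [nonlocalTerm, zero_mul, zero_div, zero_sub]
    exact neg_nonpos.2 (IsClosedCurve.arcIntegral_nonneg fun u => sq_nonneg _)
  have ha := mul_le_sub_of_le_hasDerivAt (C := 0) ht.1 (hf.continuousOn_area.mono hsub).neg
    (fun s hs => (hf.hasDerivAt_area hs.1 (hsub ⟨hs.1.le, hs.2.le⟩).2).neg)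
    (fun s hs => neg_zero.ge)
  have ha' := mul_le_sub_of_le_hasDerivAt (C := 0) ht.1 (hf.continuousOn_area.mono hsub)
    (fun s hs => hf.hasDerivAt_area hs.1 (hsub ⟨hs.1.le, hs.2.le⟩).2) (fun s hs => le_rfl)
  simp only [Pi.neg_apply] at ha
  have haeq : area (f t) = area (f 0) := by linarith
  have hiso := (hf.isClosedCurve ht).isoperimetric
  rw [haeq] at key hiso
  have := mul_pos (mul_pos (show 0 < 8 * Real.pi ^ 2 by positivity) hn) (neg_pos.2 hI)
  rw [le_div_iff₀ (by linarith)]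
  linarith

/-- The length is conserved, so D(t) − D(0) = 4πn(A(t) − A(0)) ≤ n(L(0)² − 4πA(0)). The factor n
cancels against the growth rate. -/
theorem time_le_of_LP (hf : IsClassicalSolution Flow.LP T f) (hA : 0 < area (f 0))
    (hI : isoperimetricDeficit (f 0) < 0) {t : ℝ} (ht : t ∈ timeInterval T) :
    t ≤ (length (f 0) ^ 2 - 4 * Real.pi * area (f 0)) /
      (-8 * Real.pi ^ 2 * isoperimetricDeficit (f 0)) := by
  have hn := rotationNumber_pos (hf.isClosedCurve hf.zero_mem) hA hI
  have hsub := Icc_subset_timeInterval ht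
  have hpi := Real.pi_pos
  have hdec : ∀ s ∈ Set.Ioo 0 t, nonlocalTerm Flow.LP (f s) * totalCurvature (f s) /
      length (f s) - arcIntegral (f s) (fun u => curvatureDeviation (f s) u ^ 2) = 0 :=
    fun s hs => by
      have hs' := hsub ⟨hs.1.le, hs.2.le⟩
      have hL := (hf.isClosedCurve hs').length_pos
      have hk : totalCurvature (f s) ≠ 0 := hf.defined s hs'.1 hs'.2
      rw [nonlocalTerm]
      field_simp
      ring
  have key := hf.mul_le_deficit_sub ht hn hI fun s hs => (hdec s hs).le
  have hl := mul_le_sub_of_le_hasDerivAt (C := 0) ht.1 (hf.continuousOn_length.mono hsub)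
    (fun s hs => hf.hasDerivAt_length hs.1 (hsub ⟨hs.1.le, hs.2.le⟩).2)
    (fun s hs => (hdec s hs).ge)
  have hl' := hf.length_le_length_zero ht fun s hs => (hdec s hs).le
  have hleq : length (f t) = length (f 0) := by linarith
  have hiso := (hf.isClosedCurve ht).isoperimetric
  rw [hleq] at key hiso
  have h1 : rotationNumber (f 0) * (-8 * Real.pi ^ 2 * isoperimetricDeficit (f 0) * t) ≤
      rotationNumber (f 0) * (4 * Real.pi * area (f t) - 4 * Real.pi * area (f 0)) := by
    linarith
  have h2 := le_of_mul_le_mul_left h1 hn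
  have := mul_pos (show 0 < 8 * Real.pi ^ 2 by positivity) (neg_pos.2 hI)
  rw [le_div_iff₀ (by linarith)]
  linarith

/-- A sign change would force a zero of A, where g is undefined. -/
theorem area_pos_of_JP (hf : IsClassicalSolution Flow.JP T f) (hA : 0 < area (f 0)) {t : ℝ}
    (ht : t ∈ timeInterval T) : 0 < area (f t) := by
  by_contra! h
  obtain ⟨s, hs, h0⟩ := intermediate_value_Icc' ht.1
    (hf.continuousOn_area.mono (Icc_subset_timeInterval ht)) ⟨h, hA.le⟩
  have hs' := Icc_subset_timeInterval ht hs
  exact hf.defined s hs'.1 hs'.2 h0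

/-- With A > 0, the sign of g = L²/(2A) − 2πn is opposite to that of D, so D ≥ D(0) > 0 makes A and
L nonincreasing. Dropping −L(t)² and using A(t) ≤ A(0) gives D(t) − D(0) ≤ L(0)². -/
theorem time_le_of_JP (hf : IsClassicalSolution Flow.JP T f) (hA : 0 < area (f 0))
    (hI : isoperimetricDeficit (f 0) < 0) {t : ℝ} (ht : t ∈ timeInterval T) :
    t ≤ length (f 0) ^ 2 /
      (-8 * Real.pi ^ 2 * rotationNumber (f 0) * isoperimetricDeficit (f 0)) := by
  have hX0 := hf.isClosedCurve hf.zero_mem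
  have hn := rotationNumber_pos hX0 hA hI
  have hsub := Icc_subset_timeInterval ht
  have hpi := Real.pi_pos
  have hD0 : 0 < 4 * Real.pi * rotationNumber (f 0) * area (f 0) - length (f 0) ^ 2 := by
    have hL0 := hX0.length_pos
    rw [hX0.isoperimetricDeficit_eq, neg_lt_zero] at hI
    exact (div_pos_iff_of_pos_right (by positivity)).1 hI
  have hg : ∀ s ∈ Set.Ioo 0 t, nonlocalTerm Flow.JP (f s) ≤ 0 := fun s hs => by
    have hs' := hsub ⟨hs.1.le, hs.2.le⟩
    have ha := hf.area_pos_of_JP hA hs'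
    have hD := hf.deficit_zero_le hs'
    rw [nonlocalTerm, IsClosedCurve.totalCurvature_eq, hf.rotationNumber_eq hs', sub_nonpos,
      div_le_iff₀ (by positivity)]
    linarith
  have key := hf.mul_le_deficit_sub ht hn hI fun s hs => by
    have hs' := hsub ⟨hs.1.le, hs.2.le⟩
    have hL := (hf.isClosedCurve hs').length_pos
    have hq : 0 ≤ arcIntegral (f s) (fun u => curvatureDeviation (f s) u ^ 2) :=
      IsClosedCurve.arcIntegral_nonneg fun u => sq_nonneg _
    have hk : 0 ≤ totalCurvature (f s) := by
      rw [IsClosedCurve.totalCurvature_eq, hf.rotationNumber_eq hs']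
      positivity
    have := div_nonpos_of_nonpos_of_nonneg (mul_nonpos_of_nonpos_of_nonneg (hg s hs) hk) hL.le
    linarith
  have ha := mul_le_sub_of_le_hasDerivAt (C := 0) ht.1 (hf.continuousOn_area.mono hsub).neg
    (fun s hs => (hf.hasDerivAt_area hs.1 (hsub ⟨hs.1.le, hs.2.le⟩).2).neg)
    (fun s hs => neg_nonneg.2 (hg s hs))
  simp only [Pi.neg_apply, zero_mul] at ha
  have ha2 : 0 ≤ 4 * Real.pi * rotationNumber (f 0) * (area (f 0) - area (f t)) :=
    mul_nonneg (by positivity) (by linarith)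
  have := mul_pos (mul_pos (show 0 < 8 * Real.pi ^ 2 by positivity) hn) (neg_pos.2 hI)
  rw [le_div_iff₀ (by linarith)]
  linarith [sq_nonneg (length (f t))]

end IsClassicalSolution

/-! ### From bounds on times in [0, T) to a bound on T. -/

theorem le_coe_of_forall_timeInterval_le {T : EReal} (hT : 0 < T) {b : ℝ}
    (h : ∀ t ∈ timeInterval T, t ≤ b) : T ≤ (b : EReal) := by
  by_contra! hlt
  have hb : 0 ≤ b := h 0 ⟨le_rfl, by simpa using hT⟩
  obtain ⟨t, h1, h2⟩ := EReal.lt_iff_exists_real_btwn.1 hlt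
  have h3 : b < t := EReal.coe_lt_coe_iff.1 h1
  exact h3.not_ge (h t ⟨hb.trans h3.le, h2⟩)

end PlaneFlow

theorem mainTheorem1 (F : PlaneFlow.Flow) (T : EReal) (f : ℝ → ℝ → ℂ)
    (hf : PlaneFlow.IsMaximalClassicalSolution F T f)
    (hsmooth : ContDiff ℝ ∞ (f 0))
    (n : ℝ) (hn : PlaneFlow.rotationNumber (f 0) = n)
    (hA : 0 < PlaneFlow.area (f 0))
    (hI : PlaneFlow.isoperimetricDeficit (f 0) < 0) :
    T < ⊤ ∧
    (F = PlaneFlow.Flow.AP →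
      T ≤ (((PlaneFlow.length (f 0) ^ 2 - 4 * Real.pi * PlaneFlow.area (f 0)) /
        (-8 * Real.pi ^ 2 * n * PlaneFlow.isoperimetricDeficit (f 0)) : ℝ) : EReal)) ∧
    (F = PlaneFlow.Flow.LP →
      T ≤ (((PlaneFlow.length (f 0) ^ 2 - 4 * Real.pi * PlaneFlow.area (f 0)) /
        (-8 * Real.pi ^ 2 * PlaneFlow.isoperimetricDeficit (f 0)) : ℝ) : EReal)) ∧
    (F = PlaneFlow.Flow.JP →
      T ≤ ((PlaneFlow.length (f 0) ^ 2 /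
        (-8 * Real.pi ^ 2 * n * PlaneFlow.isoperimetricDeficit (f 0)) : ℝ) : EReal)) := by

  subst hn
  have hs := hf.isSolution
  cases F with
  | AP =>
    have h := PlaneFlow.le_coe_of_forall_timeInterval_le hs.pos fun t ht =>
      hs.time_le_of_AP hA hI ht
    exact ⟨h.trans_lt (EReal.coe_lt_top _), fun _ => h, nofun, nofun⟩
  | LP =>
    have h := PlaneFlow.le_coe_of_forall_timeInterval_le hs.pos fun t ht =>
      hs.time_le_of_LP hA hI ht
    exact ⟨h.trans_lt (EReal.coe_lt_top _), nofun, fun _ => h, nofun⟩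
  | JP =>
    have h := PlaneFlow.le_coe_of_forall_timeInterval_le hs.pos fun t ht =>
      hs.time_le_of_JP hA hI ht
    exact ⟨h.trans_lt (EReal.coe_lt_top _), nofun, nofun, fun _ => h⟩
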